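/- Let $d\ge 0$ be an integer. A *measure* on $\mathbb{R}^d$ is a linear functional $\mu$ on $C_c(\mathbb{R}^d)$ (complex-valued continuous functions of compact support) such that for every compact $K\subseteq\mathbb{R}^d$ there is $a_K>0$ with $|\mu(g)|\le a_K\|g\|_\infty$ for all $g\in C_c(\mathbb{R}^d)$ with $\operatorname{supp} g\subseteq K$; its total variation $|\mu|$ is the positive regular Borel measure with $|\mu|(f)=\sup\{|\mu(g)| : g\in C_c(\mathbb{R}^d),\ |g|\le f\}$ for $0\le f\in C_c(\mathbb{R}^d)$. For $h\in L^1(|\mu|)$, $\langle\mu,h\rangle=\int h\,d\mu$ denotes the continuous extension of $\mu$ to $L^1(|\mu|)$. A measure $\mu$ is *Fourier transformable* if there is a measure $\widehat\mu$ on $\mathbb{R}^d$ (the *Fourier transform* of $\mu$) such that for all $f\in C_c(\mathbb{R}^d)$ $$\check f\in L^2(|\widehat\mu|)\qquad\text{and}\qquad \langle\mu, f*\tilde f\rangle=\langle\widehat\mu,|\check f|^2\rangle,$$ where $\tilde f(x)=\overline{f(-x)}$, $(f*g)(x)=\int f(y)g(x-y)\,dy$ and $\check f(x)=\int e^{2\pi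 i\, x\cdot y}f(y)\,dy$. A measure is *tempered* if it agrees on $C_c^\infty(\mathbb{R}^d)$ with a tempered distribution. A sequence $(\nu_n)$ of measures converges *vaguely* to a measure $\nu$ if $\nu_n(f)\to\nu(f)$ for all $f\in C_c(\mathbb{R}^d)$, and it is *equi translation bounded* if $\sup_n\sup_{t\in\mathbb{R}^d}|\nu_n|(t+K)<\infty$ for every compact $K\subseteq\mathbb{R}^d$. **Theorem.** Let $(\mu_n)_{n\in\mathbb{N}}$ be a sequence of Fourier transformable measures on $\mathbb{R}^d$ with Fourier transforms $\widehat{\mu_n}$, and let $\mu$ be a measure on $\mathbb{R}^d$ such that 1. $(\mu_n)$ converges vaguely to $\mu$, 2. $\mu$ is tempered, 3. $\{\widehat{\mu_n} : n\in\mathbb{N}\}$ is equi translation bounded. Then $\mu$ is Fourier transformable, and $\widehat{\mu_n}$ converges vaguely to $\widehat\mu$, that is, to every measure that satisfies the defining conditions of a Fourier transform of $\mu$. -/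

import Mathlib

open MeasureTheory Filter Topology
open scoped NNReal ENNReal CompactlySupported SchwartzMap FourierTransform ComplexConjugate

namespace FourierMeasure

/-- The Euclidean space `ℝ^d`. -/
abbrev Space (d : ℕ) : Type := EuclideanSpace ℝ (Fin d)

/-- A (complex Radon) measure on `ℝ^d`: a linear functional on `C_c(ℝ^d)` such that for every
compact `K` there is a constant `a > 0` with `|μ(g)| ≤ a ‖g‖_∞` for all `g ∈ C_c(ℝ^d)` supported
in `K`. -/
structure RadonMeasure (d : ℕ) where
  /-- The underlying linear functional. -/
  toLinearMap : C_c(Space d, ℂ) →ₗ[ℂ] ℂ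
  /-- Boundedness on the functions supported in a fixed compact set. -/
  bounded : ∀ K : Set (Space d), IsCompact K → ∃ a : ℝ, 0 < a ∧
    ∀ g : C_c(Space d, ℂ), tsupport g ⊆ K → ‖toLinearMap g‖ ≤ a * ⨆ x, ‖g x‖

namespace RadonMeasure

variable {d : ℕ}

noncomputable instance : CoeFun (RadonMeasure d) (fun _ => C_c(Space d, ℂ) → ℂ) :=
  ⟨fun μ => μ.toLinearMap⟩

/-- The set `{|μ(g)| : g ∈ C_c(ℝ^d), |g| ≤ f}`. -/
def variationSet (μ : RadonMeasure d) (f : C_c(Space d, ℝ≥0)) : Set ℝ≥0 :=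
  {r | ∃ g : C_c(Space d, ℂ), (∀ x, ‖g x‖₊ ≤ f x) ∧ r = ‖μ g‖₊}

lemma variationSet_nonempty (μ : RadonMeasure d) (f : C_c(Space d, ℝ≥0)) :
    (μ.variationSet f).Nonempty :=
  ⟨0, 0, by simp, by simp⟩

lemma variationSet_bddAbove (μ : RadonMeasure d) (f : C_c(Space d, ℝ≥0)) :
    BddAbove (μ.variationSet f) := by
  obtain ⟨a, ha, hK⟩ := μ.bounded (tsupport f) f.hasCompactSupport
  have hf : Continuous fun x => ((f x : ℝ≥0) : ℝ) :=
    NNReal.continuous_coe.comp (map_continuous f)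
  have hfc : HasCompactSupport fun x => ((f x : ℝ≥0) : ℝ) :=
    f.hasCompactSupport.comp_left (g := fun r : ℝ≥0 => (r : ℝ)) rfl
  obtain ⟨M, hM⟩ := hfc.exists_bound_of_continuous hf
  refine ⟨(a * M).toNNReal, ?_⟩
  rintro r ⟨g, hg, rfl⟩
  have hsub : tsupport g ⊆ tsupport f := by
    refine closure_mono fun x hx => ?_
    have h0 : g x ≠ 0 := hx
    have h1 : 0 < ‖g x‖₊ := by simpa [pos_iff_ne_zero] using h0
    exact (lt_of_lt_of_le h1 (hg x)).ne'
  have h := hK g hsub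
  have hsup : (⨆ x, ‖g x‖) ≤ M := by
    refine ciSup_le fun x => ?_
    have h1 : ‖g x‖ ≤ (f x : ℝ) := by exact_mod_cast hg x
    exact h1.trans ((le_abs_self _).trans (by simpa using hM x))
  apply NNReal.le_toNNReal_of_coe_le
  simpa using h.trans (mul_le_mul_of_nonneg_left hsup ha.le)

/-- The value `|μ|(f) = sup {|μ(g)| : g ∈ C_c(ℝ^d), |g| ≤ f}` for `f ∈ C_c(ℝ^d)`, `f ≥ 0`. -/
noncomputable def variation (μ : RadonMeasure d) (f : C_c(Space d, ℝ≥0)) : ℝ≥0 :=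
  sSup (μ.variationSet f)

lemma le_variation (μ : RadonMeasure d) (f : C_c(Space d, ℝ≥0)) (g : C_c(Space d, ℂ))
    (hg : ∀ x, ‖g x‖₊ ≤ f x) : ‖μ g‖₊ ≤ μ.variation f :=
  le_csSup (μ.variationSet_bddAbove f) ⟨g, hg, rfl⟩

lemma variation_le (μ : RadonMeasure d) (f : C_c(Space d, ℝ≥0)) (r : ℝ≥0)
    (h : ∀ g : C_c(Space d, ℂ), (∀ x, ‖g x‖₊ ≤ f x) → ‖μ g‖₊ ≤ r) : μ.variation f ≤ r := by
  refine csSup_le (μ.variationSet_nonempty f) ?_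
  rintro _ ⟨g, hg, rfl⟩
  exact h g hg

/-- A compactly supported continuous function `g` with `|g| ≤ f₁ + f₂` has a part dominated
by `f₁`, namely `g f₁ / (f₁ + f₂)`. -/
lemma exists_part (f₁ f₂ : C_c(Space d, ℝ≥0)) (g : C_c(Space d, ℂ))
    (hg : ∀ x, ‖g x‖₊ ≤ (f₁ + f₂) x) :
    ∃ g₁ : C_c(Space d, ℂ), (∀ x, ‖g₁ x‖₊ ≤ f₁ x) ∧ ∀ x, ‖(g - g₁) x‖₊ ≤ f₂ x := by
  have hg' : ∀ x, ‖g x‖ ≤ (f₁ x : ℝ) + f₂ x := fun x => by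
    have := hg x
    exact_mod_cast this
  let q : Space d → ℝ := fun x => (f₁ x : ℝ) / ((f₁ x : ℝ) + f₂ x)
  have hq0 : ∀ x, 0 ≤ q x := fun x => by positivity
  have hq1 : ∀ x, q x ≤ 1 := fun x =>
    div_le_one_of_le₀ (by simp) (by positivity)
  have hf1 : Continuous fun x => ((f₁ x : ℝ≥0) : ℝ) :=
    NNReal.continuous_coe.comp (map_continuous f₁)
  have hf2 : Continuous fun x => ((f₂ x : ℝ≥0) : ℝ) :=
    NNReal.continuous_coe.comp (map_continuous f₂)
  have hnorm : ∀ x, ‖g x * (q x : ℂ)‖ = ‖g x‖ * q x := fun x => by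
    rw [norm_mul, Complex.norm_real, Real.norm_of_nonneg (hq0 x)]
  have hcont : Continuous fun x => g x * (q x : ℂ) := by
    rw [continuous_iff_continuousAt]
    intro x
    by_cases hx : (f₁ x : ℝ) + f₂ x = 0
    · have hgx : g x = 0 := by
        have := hg' x
        rw [hx] at this
        exact norm_le_zero_iff.mp this
      have hz : g x * (q x : ℂ) = 0 := by simp [hgx]
      rw [ContinuousAt, hz]
      refine squeeze_zero_norm (a := fun y => ‖g y‖) (fun y => ?_) ?_
      · rw [hnorm]
        exact mul_le_of_le_one_right (norm_nonneg _) (hq1 y)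
      · have := (map_continuous g).norm.tendsto x
        simpa [hgx] using this
    · have hqc : ContinuousAt q x :=
        hf1.continuousAt.div (hf1.add hf2).continuousAt hx
      exact (map_continuous g).continuousAt.mul
        (Complex.continuous_ofReal.continuousAt.comp hqc)
  refine ⟨⟨⟨fun x => g x * (q x : ℂ), hcont⟩, g.hasCompactSupport.mul_right⟩, fun x => ?_,
    fun x => ?_⟩
  · rw [← NNReal.coe_le_coe]
    change ‖g x * (q x : ℂ)‖ ≤ f₁ x
    rw [hnorm]
    by_cases hx : (f₁ x : ℝ) + f₂ x = 0
    · have h0 : q x = 0 := by simp [q, hx]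
      simp [h0]
    · calc ‖g x‖ * q x ≤ ((f₁ x : ℝ) + f₂ x) * q x :=
            mul_le_mul_of_nonneg_right (hg' x) (hq0 x)
        _ = f₁ x := mul_div_cancel₀ _ hx
  · rw [← NNReal.coe_le_coe]
    change ‖g x - g x * (q x : ℂ)‖ ≤ f₂ x
    have h1 : g x - g x * (q x : ℂ) = g x * ((1 - q x : ℝ) : ℂ) := by
      push_cast
      ring
    rw [h1, norm_mul, Complex.norm_real, Real.norm_of_nonneg (sub_nonneg.mpr (hq1 x))]
    by_cases hx : (f₁ x : ℝ) + f₂ x = 0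
    · have hgx : ‖g x‖ ≤ 0 := hx ▸ hg' x
      have hgx' : ‖g x‖ = 0 := le_antisymm hgx (norm_nonneg _)
      simp [hgx']
    · calc ‖g x‖ * (1 - q x) ≤ ((f₁ x : ℝ) + f₂ x) * (1 - q x) :=
            mul_le_mul_of_nonneg_right (hg' x) (sub_nonneg.mpr (hq1 x))
        _ = f₂ x := by
            rw [mul_sub, mul_one, show ((f₁ x : ℝ) + f₂ x) * q x = f₁ x from
              mul_div_cancel₀ _ hx]
            ring

lemma exists_phase (z : ℂ) : ∃ u : ℂ, ‖u‖ ≤ 1 ∧ u * z = (‖z‖ : ℂ) := by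
  by_cases hz : z = 0
  · exact ⟨0, by simp, by simp [hz]⟩
  · have hn : (‖z‖ : ℂ) ≠ 0 := by simpa using hz
    refine ⟨(‖z‖ : ℂ) / z, ?_, div_mul_cancel₀ _ hz⟩
    simp [hz]

lemma variation_add (μ : RadonMeasure d) (f₁ f₂ : C_c(Space d, ℝ≥0)) :
    μ.variation (f₁ + f₂) = μ.variation f₁ + μ.variation f₂ := by
  apply le_antisymm
  · refine μ.variation_le _ _ fun g hg => ?_
    obtain ⟨g₁, h₁, h₂⟩ := exists_part f₁ f₂ g hg
    calc ‖μ g‖₊ = ‖μ g₁ + μ (g - g₁)‖₊ := by rw [← map_add]; simp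
      _ ≤ ‖μ g₁‖₊ + ‖μ (g - g₁)‖₊ := nnnorm_add_le _ _
      _ ≤ _ := add_le_add (μ.le_variation _ _ h₁) (μ.le_variation _ _ h₂)
  · have key : ∀ g₁ g₂ : C_c(Space d, ℂ), (∀ x, ‖g₁ x‖₊ ≤ f₁ x) → (∀ x, ‖g₂ x‖₊ ≤ f₂ x) →
        ‖μ g₁‖₊ + ‖μ g₂‖₊ ≤ μ.variation (f₁ + f₂) := by
      intro g₁ g₂ h₁ h₂
      obtain ⟨u₁, hu₁, e₁⟩ := exists_phase (μ g₁)
      obtain ⟨u₂, hu₂, e₂⟩ := exists_phase (μ g₂)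
      have hb : ∀ x, ‖(u₁ • g₁ + u₂ • g₂) x‖₊ ≤ (f₁ + f₂) x := fun x => by
        have hu₁' : ‖u₁‖₊ ≤ 1 := hu₁
        have hu₂' : ‖u₂‖₊ ≤ 1 := hu₂
        calc ‖u₁ * g₁ x + u₂ * g₂ x‖₊ ≤ ‖u₁ * g₁ x‖₊ + ‖u₂ * g₂ x‖₊ := nnnorm_add_le _ _
          _ = ‖u₁‖₊ * ‖g₁ x‖₊ + ‖u₂‖₊ * ‖g₂ x‖₊ := by rw [nnnorm_mul, nnnorm_mul]
          _ ≤ 1 * f₁ x + 1 * f₂ x :=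
            add_le_add (mul_le_mul' hu₁' (h₁ x)) (mul_le_mul' hu₂' (h₂ x))
          _ = (f₁ + f₂) x := by simp
      have h := μ.le_variation _ _ hb
      rw [map_add, map_smul, map_smul, smul_eq_mul, smul_eq_mul, e₁, e₂] at h
      have h3 : ‖((‖μ g₁‖ : ℂ) + (‖μ g₂‖ : ℂ))‖₊ = ‖μ g₁‖₊ + ‖μ g₂‖₊ := by
        rw [← NNReal.coe_inj, coe_nnnorm, ← Complex.ofReal_add, Complex.norm_real,
          Real.norm_of_nonneg (by positivity)]
        simp
      rwa [h3] at h
    have step : ∀ g₂ : C_c(Space d, ℂ), (∀ x, ‖g₂ x‖₊ ≤ f₂ x) →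
        ‖μ g₂‖₊ ≤ μ.variation (f₁ + f₂) - μ.variation f₁ := by
      intro g₂ h₂
      have h1 : μ.variation f₁ ≤ μ.variation (f₁ + f₂) - ‖μ g₂‖₊ :=
        μ.variation_le _ _ fun g₁ h₁ => le_tsub_of_add_le_right (key g₁ g₂ h₁ h₂)
      have h0 : ‖μ g₂‖₊ ≤ μ.variation (f₁ + f₂) := le_of_add_le_right
        (key 0 g₂ (by simp) h₂)
      have h2 := (le_tsub_iff_right h0).mp h1
      exact le_tsub_of_add_le_left h2
    have h1 : μ.variation f₁ ≤ μ.variation (f₁ + f₂) :=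
      μ.variation_le _ _ fun g₁ h₁ => le_of_add_le_left (key g₁ 0 h₁ (by simp))
    have h2 : μ.variation f₂ ≤ μ.variation (f₁ + f₂) - μ.variation f₁ :=
      μ.variation_le _ _ step
    have h3 := (le_tsub_iff_right h1).mp h2
    rwa [add_comm] at h3

lemma variation_smul_le (μ : RadonMeasure d) (c : ℝ≥0) (f : C_c(Space d, ℝ≥0)) :
    c * μ.variation f ≤ μ.variation (c • f) := by
  by_cases hc : c = 0
  · simp [hc]
  · rw [mul_comm, ← le_div_iff₀ (pos_iff_ne_zero.mpr hc)]
    refine μ.variation_le _ _ fun g hg => ?_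
    rw [le_div_iff₀ (pos_iff_ne_zero.mpr hc)]
    have h := μ.le_variation (c • f) (((c : ℝ) : ℂ) • g) fun x => by
      change ‖((c : ℝ) : ℂ) * g x‖₊ ≤ c * f x
      rw [nnnorm_mul]
      simpa using mul_le_mul_right (hg x) c
    rw [map_smul, smul_eq_mul, nnnorm_mul] at h
    simpa [mul_comm] using h

lemma variation_smul (μ : RadonMeasure d) (c : ℝ≥0) (f : C_c(Space d, ℝ≥0)) :
    μ.variation (c • f) = c * μ.variation f := by
  refine le_antisymm ?_ (μ.variation_smul_le c f)
  by_cases hc : c = 0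
  · subst hc
    refine μ.variation_le _ _ fun g hg => ?_
    have hg0 : g = 0 := by
      ext x
      have := hg x
      simpa using this
    simp [hg0]
  · have h := μ.variation_smul_le c⁻¹ (c • f)
    rw [smul_smul, inv_mul_cancel₀ hc, one_smul] at h
    calc μ.variation (c • f) = c * (c⁻¹ * μ.variation (c • f)) := by
          rw [← mul_assoc, mul_inv_cancel₀ hc, one_mul]
      _ ≤ _ := mul_le_mul_right h c

/-- `|μ|` as a positive linear functional on `C_c(ℝ^d)`. -/
noncomputable def variationLinearMap (μ : RadonMeasure d) : C_c(Space d, ℝ≥0) →ₗ[ℝ≥0] ℝ≥0 where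
  toFun := μ.variation
  map_add' := μ.variation_add
  map_smul' c f := by simpa using μ.variation_smul c f

/-- The total variation `|μ|`, as the regular Borel measure representing the positive functional
`f ↦ sup {|μ(g)| : g ∈ C_c(ℝ^d), |g| ≤ f}`. -/
noncomputable def totalVariation (μ : RadonMeasure d) : Measure (Space d) :=
  NNRealRMK.rieszMeasure μ.variationLinearMap

/-- `μ.HasIntegral h c`: the function `h` belongs to `L¹(|μ|)` and `⟨μ, h⟩ = ∫ h dμ = c`. The
integral against `μ` is the extension of `μ` from `C_c(ℝ^d)` to `L¹(|μ|)` by continuity, that is,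
`c` is the limit of `μ(g)` as `g ∈ C_c(ℝ^d)` tends to `h` in `L¹(|μ|)`. -/
def HasIntegral (μ : RadonMeasure d) (h : Space d → ℂ) (c : ℂ) : Prop :=
  Integrable h μ.totalVariation ∧
    ∀ ε : ℝ, 0 < ε → ∃ g : C_c(Space d, ℂ),
      ∫ x, ‖h x - g x‖ ∂μ.totalVariation ≤ ε ∧ ‖μ g - c‖ ≤ ε

/-- The norm `‖μ‖_K = sup_{t ∈ ℝ^d} |μ|(t + K)`. -/
noncomputable def translationNorm (μ : RadonMeasure d) (K : Set (Space d)) : ℝ≥0∞ :=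
  ⨆ t : Space d, μ.totalVariation ((fun x => t + x) '' K)

/-- A sequence of measures is equi translation bounded if `sup_n ‖μ_n‖_K < ∞` for every
compact `K`. -/
def EquiTranslationBounded (μ : ℕ → RadonMeasure d) : Prop :=
  ∀ K : Set (Space d), IsCompact K → ⨆ n, (μ n).translationNorm K < ∞

/-- Vague convergence: `μ_n(f) → μ(f)` for all `f ∈ C_c(ℝ^d)`. -/
def VagueTendsto (μ : ℕ → RadonMeasure d) (μ' : RadonMeasure d) : Prop :=
  ∀ f : C_c(Space d, ℂ), Tendsto (fun n => μ n f) atTop (𝓝 (μ' f))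

/-- A measure is tempered if it is (the restriction to test functions of) a tempered
distribution. -/
def IsTempered (μ : RadonMeasure d) : Prop :=
  ∃ T : 𝓢'(Space d, ℂ), ∀ (φ : 𝓢(Space d, ℂ)) (hφ : HasCompactSupport φ),
    T φ = μ ⟨⟨φ, φ.continuous⟩, hφ⟩

end RadonMeasure

variable {d : ℕ}

/-- `f̃(x) = conj (f (-x))`. -/
noncomputable def tilde (f : C_c(Space d, ℂ)) : C_c(Space d, ℂ) where
  toFun x := conj (f (-x))
  continuous_toFun := Complex.continuous_conj.comp ((map_continuous f).comp continuous_neg)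
  hasCompactSupport' :=
    (f.hasCompactSupport.comp_homeomorph (Homeomorph.neg (Space d))).comp_left
      (g := fun z : ℂ => conj z) (map_zero _)

/-- The convolution `(f * g)(x) = ∫ f(y) g(x - y) dy` of two functions in `C_c(ℝ^d)`. -/
noncomputable def conv (f g : C_c(Space d, ℂ)) : C_c(Space d, ℂ) where
  toFun x := ∫ y, f y * g (x - y)
  continuous_toFun :=
    g.hasCompactSupport.continuous_convolution_right (ContinuousLinearMap.mul ℂ ℂ)
      ((map_continuous f).locallyIntegrable (μ := volume)) (map_continuous g)
  hasCompactSupport' :=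
    HasCompactSupport.convolution (ContinuousLinearMap.mul ℂ ℂ) (μ := volume)
      f.hasCompactSupport g.hasCompactSupport

/-- `ν` is the Fourier transform of the measure `μ`: for every `f ∈ C_c(ℝ^d)`, the inverse Fourier
transform `f̌(x) = ∫ exp(2πi⟨x, y⟩) f(y) dy` belongs to `L²(|ν|)`, and
`⟨μ, f * f̃⟩ = ⟨ν, |f̌|²⟩`. -/
def IsFourierTransform (μ ν : RadonMeasure d) : Prop :=
  ∀ f : C_c(Space d, ℂ), MemLp (𝓕⁻ (f : Space d → ℂ)) 2 ν.totalVariation ∧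
    ν.HasIntegral (fun x => ((‖𝓕⁻ (f : Space d → ℂ) x‖ ^ 2 : ℝ) : ℂ)) (μ (conv f (tilde f)))

/-- A measure is Fourier transformable if it has a Fourier transform that is a measure. -/
def FourierTransformable (μ : RadonMeasure d) : Prop :=
  ∃ ν : RadonMeasure d, IsFourierTransform μ ν

end FourierMeasure

namespace FourierMeasure

variable {d : ℕ}

/-! ### Integration against a Radon measure. -/

namespace RadonMeasure

/-! The values of a Fourier transform on `C_c` can be recovered from the measure up to a controlled
error. Given φ, pick g in `C_c` with ǧ ≠ 0 on supp φ. The quotient φ/|ǧ|² lies in `C_c`, hence is a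
uniform limit of functions ȟ with h in `C_c`; with k = g * h, the product ǩ·conj ǧ = |ǧ|²ȟ is within
ε|ǧ|² of φ. The polarized defining identity then puts ν(φ) within ε∫|ǧ|² d|ν| of μ(k * g̃)
(`exists_fourierInv_mul_conj_near`, `IsFourierTransform.norm_apply_sub_le`). Since g does not depend
on ε, this already gives uniqueness (`IsFourierTransform.eq_apply`).

For a sequence, ∫|ǧ|² d|ν_n| has to be bounded in n. By `exists_dominating`, |ǧ|² is dominated on
unit balls by a Lebesgue integrable function, so its integral is controlled by the largest mass of a
unit ball. Hence ν_n(φ) is Cauchy whenever μ_n(k * g̃) converges, and the limits define a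
translation bounded measure ν (`exists_tendsto_apply`, `RadonMeasure.exists_vagueTendsto`).

The same domination makes the tails of |f̌|² uniformly small, so |f̌|² can be cut off to a `C_c`
function and the defining identity passes to the limit (`isFourierTransform_of_vagueTendsto`). By
uniqueness ν is the only candidate. -/

instance regular_totalVariation (μ : RadonMeasure d) : μ.totalVariation.Regular := by
  unfold totalVariation
  infer_instance

/-- The function `x ↦ ‖g x‖₊` in `C_c(ℝ^d)`. -/
noncomputable def nnnormFun (g : C_c(Space d, ℂ)) : C_c(Space d, ℝ≥0) where
  toFun x := ‖g x‖₊
  continuous_toFun := (map_continuous g).nnnorm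
  hasCompactSupport' := g.hasCompactSupport.comp_left (g := fun z : ℂ => ‖z‖₊) nnnorm_zero

lemma integrable_totalVariation (μ : RadonMeasure d) (g : C_c(Space d, ℂ)) :
    Integrable g μ.totalVariation :=
  (map_continuous g).integrable_of_hasCompactSupport g.hasCompactSupport

lemma norm_apply_le_integral (μ : RadonMeasure d) (g : C_c(Space d, ℂ)) :
    ‖μ g‖ ≤ ∫ x, ‖g x‖ ∂μ.totalVariation := by
  have h : ‖μ g‖₊ ≤ μ.variation (nnnormFun g) := μ.le_variation _ g fun _ => le_rfl
  have h2 : ∫ x, ‖g x‖ ∂μ.totalVariation = (μ.variation (nnnormFun g) : ℝ) :=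
    NNRealRMK.integral_rieszMeasure μ.variationLinearMap (nnnormFun g)
  rw [h2]
  exact_mod_cast h

/-- Compare g with an approximant from the definition, using that μ is a contraction for the L¹(|μ|)
norm. This estimate replaces a full integration theory against μ. -/
lemma HasIntegral.norm_sub_le {μ : RadonMeasure d} {f : Space d → ℂ} {c : ℂ}
    (h : μ.HasIntegral f c) (g : C_c(Space d, ℂ)) :
    ‖μ g - c‖ ≤ ∫ x, ‖f x - g x‖ ∂μ.totalVariation := by
  refine le_of_forall_pos_le_add fun ε hε => ?_
  obtain ⟨g', h1, h2⟩ := h.2 (ε / 2) (half_pos hε)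
  have hg := h.1.sub (μ.integrable_totalVariation g)
  have hg' := h.1.sub (μ.integrable_totalVariation g')
  have h3 : ‖μ (g - g')‖ ≤ (∫ x, ‖f x - g x‖ ∂μ.totalVariation) + ε / 2 := by
    refine (μ.norm_apply_le_integral _).trans ?_
    refine le_trans ?_ (add_le_add_right h1 _)
    rw [← integral_add (f := fun x => ‖f x - g x‖) (g := fun x => ‖f x - g' x‖) hg.norm hg'.norm]
    refine integral_mono (μ.integrable_totalVariation _).norm (hg.norm.add hg'.norm) fun x => ?_
    have : (g - g') x = (f x - g' x) - (f x - g x) := by simp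
    change ‖(g - g') x‖ ≤ ‖f x - g x‖ + ‖f x - g' x‖
    rw [this, add_comm]
    exact _root_.norm_sub_le _ _
  have h4 : μ g - c = μ (g - g') + (μ g' - c) := by rw [map_sub]; ring
  rw [h4]
  refine (norm_add_le _ _).trans ?_
  linarith

lemma HasIntegral.add {μ : RadonMeasure d} {f₁ f₂ : Space d → ℂ} {c₁ c₂ : ℂ}
    (h₁ : μ.HasIntegral f₁ c₁) (h₂ : μ.HasIntegral f₂ c₂) :
    μ.HasIntegral (fun x => f₁ x + f₂ x) (c₁ + c₂) := by
  refine ⟨h₁.1.add h₂.1, fun ε hε => ?_⟩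
  obtain ⟨g₁, a₁, b₁⟩ := h₁.2 (ε / 2) (half_pos hε)
  obtain ⟨g₂, a₂, b₂⟩ := h₂.2 (ε / 2) (half_pos hε)
  refine ⟨g₁ + g₂, ?_, ?_⟩
  · have i₁ := h₁.1.sub (μ.integrable_totalVariation g₁)
    have i₂ := h₂.1.sub (μ.integrable_totalVariation g₂)
    calc ∫ x, ‖f₁ x + f₂ x - (g₁ + g₂) x‖ ∂μ.totalVariation
        ≤ ∫ x, (‖f₁ x - g₁ x‖ + ‖f₂ x - g₂ x‖) ∂μ.totalVariation := by
          refine integral_mono ((h₁.1.add h₂.1).sub (μ.integrable_totalVariation _)).norm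
            (i₁.norm.add i₂.norm) fun x => ?_
          change ‖f₁ x + f₂ x - (g₁ x + g₂ x)‖ ≤ _
          rw [add_sub_add_comm]
          exact norm_add_le _ _
      _ = _ := integral_add i₁.norm i₂.norm
      _ ≤ ε := by linarith
  · rw [map_add, add_sub_add_comm]
    exact (norm_add_le _ _).trans (by linarith)

lemma HasIntegral.const_mul {μ : RadonMeasure d} {f : Space d → ℂ} {c : ℂ}
    (h : μ.HasIntegral f c) (a : ℂ) : μ.HasIntegral (fun x => a * f x) (a * c) := by
  refine ⟨h.1.const_mul a, fun ε hε => ?_⟩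
  have hpos : 0 < ‖a‖ + 1 := by positivity
  obtain ⟨g, h1, h2⟩ := h.2 (ε / (‖a‖ + 1)) (div_pos hε hpos)
  have hle : ‖a‖ * (ε / (‖a‖ + 1)) ≤ ε := by
    rw [mul_div_assoc', div_le_iff₀ hpos]
    nlinarith
  refine ⟨a • g, ?_, ?_⟩
  · have : ∀ x, ‖a * f x - (a • g) x‖ = ‖a‖ * ‖f x - g x‖ := fun x => by
      rw [← norm_mul, mul_sub]; rfl
    simp_rw [this]
    rw [integral_const_mul]
    exact (mul_le_mul_of_nonneg_left h1 (norm_nonneg _)).trans hle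
  · rw [map_smul, smul_eq_mul, ← mul_sub, norm_mul]
    exact (mul_le_mul_of_nonneg_left h2 (norm_nonneg _)).trans hle

end RadonMeasure

/-! ### Inverse Fourier transform, convolution and polarization on `C_c`. -/

lemma integrable_volume (g : C_c(Space d, ℂ)) : Integrable g :=
  (map_continuous g).integrable_of_hasCompactSupport g.hasCompactSupport

lemma continuous_fourierInv {f : Space d → ℂ} (hf : Integrable f) : Continuous (𝓕⁻ f) :=
  VectorFourier.fourierIntegral_continuous Real.continuous_fourierChar
    (L := -innerₗ (Space d)) (continuous_inner (𝕜 := ℝ)).neg hf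

lemma fourierInv_add_apply {f g : Space d → ℂ} (hf : Integrable f) (hg : Integrable g)
    (x : Space d) : 𝓕⁻ (fun y => f y + g y) x = 𝓕⁻ f x + 𝓕⁻ g x :=
  congrFun (VectorFourier.fourierIntegral_add Real.continuous_fourierChar
    (L := -innerₗ (Space d)) (continuous_inner (𝕜 := ℝ)).neg hf hg) x

lemma fourierInv_const_mul_apply (a : ℂ) (f : Space d → ℂ) (x : Space d) :
    𝓕⁻ (fun y => a * f y) x = a * 𝓕⁻ f x := by
  rw [Real.fourierInv_eq', Real.fourierInv_eq', ← integral_const_mul]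
  congr 1 with y
  simp only [smul_eq_mul]
  ring

lemma norm_fourierInv_le (f : Space d → ℂ) (x : Space d) : ‖𝓕⁻ f x‖ ≤ ∫ y, ‖f y‖ :=
  VectorFourier.norm_fourierIntegral_le_integral_norm _ _ _ _ _

lemma norm_fourierInv_sub_le {f g : Space d → ℂ} (hf : Integrable f) (hg : Integrable g)
    (x : Space d) : ‖𝓕⁻ f x - 𝓕⁻ g x‖ ≤ ∫ y, ‖f y - g y‖ := by
  have h := norm_fourierInv_le (fun y => f y - g y) x
  have h2 := fourierInv_add_apply (hf.sub hg) hg x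
  simp only [Pi.sub_apply, sub_add_cancel] at h2
  rwa [show 𝓕⁻ f x - 𝓕⁻ g x = 𝓕⁻ (fun y => f y - g y) x from sub_eq_of_eq_add h2]

lemma fourierInv_conv (f g : C_c(Space d, ℂ)) (x : Space d) :
    𝓕⁻ (conv f g : Space d → ℂ) x = 𝓕⁻ (f : Space d → ℂ) x * 𝓕⁻ (g : Space d → ℂ) x := by
  simp_rw [Real.fourierInv_eq_fourier_neg]
  exact Real.fourier_mul_convolution_eq (integrable_volume f) (integrable_volume g) (-x)

lemma integrable_conv (f g : C_c(Space d, ℂ)) (x : Space d) :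
    Integrable fun y => f y * g (x - y) :=
  ((map_continuous f).mul ((map_continuous g).comp (by fun_prop))).integrable_of_hasCompactSupport
    f.hasCompactSupport.mul_right

lemma conv_add_left (f₁ f₂ g : C_c(Space d, ℂ)) : conv (f₁ + f₂) g = conv f₁ g + conv f₂ g := by
  ext x
  change ∫ y, (f₁ y + f₂ y) * g (x - y) = (∫ y, f₁ y * g (x - y)) + ∫ y, f₂ y * g (x - y)
  simp_rw [add_mul]
  exact integral_add (integrable_conv _ _ _) (integrable_conv _ _ _)

lemma conv_add_right (f g₁ g₂ : C_c(Space d, ℂ)) : conv f (g₁ + g₂) = conv f g₁ + conv f g₂ := by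
  ext x
  change ∫ y, f y * (g₁ (x - y) + g₂ (x - y)) =
    (∫ y, f y * g₁ (x - y)) + ∫ y, f y * g₂ (x - y)
  simp_rw [mul_add]
  exact integral_add (integrable_conv _ _ _) (integrable_conv _ _ _)

lemma conv_smul_left (a : ℂ) (f g : C_c(Space d, ℂ)) : conv (a • f) g = a • conv f g := by
  ext x
  change ∫ y, a * f y * g (x - y) = a * ∫ y, f y * g (x - y)
  simp_rw [mul_assoc]
  exact integral_const_mul _ _

lemma conv_smul_right (a : ℂ) (f g : C_c(Space d, ℂ)) : conv f (a • g) = a • conv f g := by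
  ext x
  change ∫ y, f y * (a * g (x - y)) = a * ∫ y, f y * g (x - y)
  simp_rw [mul_left_comm]
  exact integral_const_mul _ _

lemma tilde_add (f g : C_c(Space d, ℂ)) : tilde (f + g) = tilde f + tilde g := by
  ext x
  exact map_add (starRingEnd ℂ) _ _

lemma tilde_smul (a : ℂ) (f : C_c(Space d, ℂ)) : tilde (a • f) = conj a • tilde f := by
  ext x
  exact map_mul (starRingEnd ℂ) _ _

lemma conv_polarization (f g : C_c(Space d, ℂ)) :
    conv f (tilde g) = (1 / 4 : ℂ) • (conv (f + g) (tilde (f + g)) +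
      (-1 : ℂ) • conv (f + (-1 : ℂ) • g) (tilde (f + (-1 : ℂ) • g)) +
      Complex.I • conv (f + Complex.I • g) (tilde (f + Complex.I • g)) +
      (-Complex.I) • conv (f + (-Complex.I) • g) (tilde (f + (-Complex.I) • g))) := by
  simp only [tilde_add, tilde_smul, conv_add_left, conv_add_right, conv_smul_left,
    conv_smul_right, map_neg, Complex.conj_I, map_one]
  ext x
  simp only [CompactlySupportedContinuousMap.coe_add, Pi.add_apply,
    CompactlySupportedContinuousMap.coe_smul, Pi.smul_apply, smul_eq_mul]
  linear_combination ((conv f (tilde g)) x * (1 / 2) + (conv g (tilde f)) x * (-1 / 2)) * Complex.I_sq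

/-- Both sides are sesquilinear in (f, g), so the diagonal case determines them by polarization. -/
lemma IsFourierTransform.hasIntegral_mul_conj {μ ν : RadonMeasure d}
    (h : IsFourierTransform μ ν) (f g : C_c(Space d, ℂ)) :
    ν.HasIntegral (fun x => 𝓕⁻ (f : Space d → ℂ) x * conj (𝓕⁻ (g : Space d → ℂ) x))
      (μ (conv f (tilde g))) := by
  have key := (((((h (f + g)).2.add ((h (f + (-1 : ℂ) • g)).2.const_mul (-1))).add
    ((h (f + Complex.I • g)).2.const_mul Complex.I)).add
    ((h (f + (-Complex.I) • g)).2.const_mul (-Complex.I)))).const_mul (1 / 4 : ℂ)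
  rw [conv_polarization, map_smul, map_add, map_add, map_add, map_smul, map_smul, map_smul]
  simp only [smul_eq_mul]
  convert key using 1
  ext x
  have e : ∀ a : ℂ, 𝓕⁻ ((f + a • g : C_c(Space d, ℂ)) : Space d → ℂ) x =
      𝓕⁻ (f : Space d → ℂ) x + a * 𝓕⁻ (g : Space d → ℂ) x := fun a => by
    rw [← fourierInv_const_mul_apply]
    exact fourierInv_add_apply (integrable_volume f) ((integrable_volume g).const_mul a) x
  have e1 : 𝓕⁻ ((f + g : C_c(Space d, ℂ)) : Space d → ℂ) x =
      𝓕⁻ (f : Space d → ℂ) x + 𝓕⁻ (g : Space d → ℂ) x := by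
    simpa using e 1
  simp only [e, e1, Complex.ofReal_pow, ← Complex.mul_conj', map_add, map_mul, map_neg,
    Complex.conj_I, map_one]
  set a := 𝓕⁻ (f : Space d → ℂ) x
  set b := 𝓕⁻ (g : Space d → ℂ) x
  linear_combination (a * conj b * (1 / 2) + b * conj a * (-1 / 2)) * Complex.I_sq

/-! ### Approximation by transforms of `C_c` functions, and uniqueness. -/

lemma exists_schwartzMap_near (g : C_c(Space d, ℂ)) {ε : ℝ} (hε : 0 < ε) :
    ∃ s : 𝓢(Space d, ℂ), (∀ x, ‖s x - g x‖ ≤ ε) ∧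
      Function.support s ⊆ Function.support g := by
  obtain ⟨s, h1, h2, h3⟩ := (map_continuous g).exists_contDiff_approx (⊤ : ℕ∞)
    (continuous_const (y := ε)) fun _ => hε
  have hs : HasCompactSupport s := g.hasCompactSupport.mono h3
  exact ⟨hs.toSchwartzMap h1, fun x => (dist_eq_norm (s x) (g x)) ▸ (h2 x).le, h3⟩

/-- Functions in `C_c(ℝ^d)` are uniform limits of Fourier transforms of functions in `C_c(ℝ^d)`. -/
lemma exists_fourierInv_near (ψ : C_c(Space d, ℂ)) {ε : ℝ} (hε : 0 < ε) :
    ∃ h : C_c(Space d, ℂ), ∀ x, ‖ψ x - 𝓕⁻ (h : Space d → ℂ) x‖ ≤ ε := by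
  obtain ⟨s, hs, -⟩ := exists_schwartzMap_near ψ (half_pos hε)
  -- As s is the inverse transform of `𝓕 s`, an L¹ approximation of `𝓕 s` becomes a uniform
  -- approximation of s.
  obtain ⟨h, hc, hle, hcont, hint⟩ :=
    ((𝓕 s).integrable (μ := volume)).exists_hasCompactSupport_integral_sub_le (half_pos hε)
  refine ⟨⟨⟨h, hcont⟩, hc⟩, fun x => ?_⟩
  have h1 : s x = 𝓕⁻ ((𝓕 s : 𝓢(Space d, ℂ)) : Space d → ℂ) x := by
    rw [← SchwartzMap.fourierInv_coe]
    simp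
  have h2 : ‖s x - 𝓕⁻ h x‖ ≤ ε / 2 := by
    rw [h1]
    exact (norm_fourierInv_sub_le (𝓕 s).integrable hint x).trans hle
  have h3 : ‖ψ x - s x‖ ≤ ε / 2 := by
    rw [norm_sub_rev]
    exact hs x
  change ‖ψ x - 𝓕⁻ h x‖ ≤ ε
  calc ‖ψ x - 𝓕⁻ h x‖ ≤ ‖ψ x - s x‖ + ‖s x - 𝓕⁻ h x‖ := norm_sub_le_norm_sub_add_norm_sub _ _ _
    _ ≤ ε := by linarith

/-- A compactly supported cutoff function. -/
lemma exists_cutoff {K : Set (Space d)} (hK : IsCompact K) :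
    ∃ χ : C_c(Space d, ℂ), (∀ x ∈ K, χ x = 1) ∧ ∀ x, ‖χ x‖ ≤ 1 ∧ ‖1 - χ x‖ ≤ 1 := by
  obtain ⟨χ, h1, -, h2, h3⟩ := exists_continuous_one_zero_of_isCompact hK isClosed_empty
    (Set.disjoint_empty K)
  refine ⟨⟨⟨fun x => (χ x : ℂ), by fun_prop⟩, h2.comp_left (g := fun r : ℝ => (r : ℂ)) rfl⟩,
    fun x hx => ?_, fun x => ⟨?_, ?_⟩⟩
  · change ((χ x : ℝ) : ℂ) = 1
    rw [h1 hx]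
    simp
  · change ‖((χ x : ℝ) : ℂ)‖ ≤ 1
    rw [Complex.norm_real, Real.norm_of_nonneg (h3 x).1]
    exact (h3 x).2
  · change ‖1 - ((χ x : ℝ) : ℂ)‖ ≤ 1
    rw [← Complex.ofReal_one, ← Complex.ofReal_sub, Complex.norm_real,
      Real.norm_of_nonneg (sub_nonneg.2 (h3 x).2)]
    linarith [(h3 x).1]

/-- A transform within 1/2 of a cutoff equal to 1 on K cannot vanish there. -/
lemma exists_fourierInv_ne_zero {K : Set (Space d)} (hK : IsCompact K) :
    ∃ g : C_c(Space d, ℂ), ∀ x ∈ K, 𝓕⁻ (g : Space d → ℂ) x ≠ 0 := by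
  obtain ⟨χ, h1, -⟩ := exists_cutoff hK
  obtain ⟨g, hg⟩ := exists_fourierInv_near χ one_half_pos
  refine ⟨g, fun x hx h0 => ?_⟩
  have := hg x
  rw [h1 x hx, h0] at this
  norm_num at this

/-- Approximate φ/|ǧ|² uniformly by ȟ and multiply back by |ǧ|². The order of quantifiers matters: g
is fixed before ε, so ∫|ǧ|² d|ν| stays fixed as ε tends to 0. -/
lemma exists_fourierInv_mul_conj_near (φ : C_c(Space d, ℂ)) : ∃ g : C_c(Space d, ℂ),
    ∀ ε : ℝ, 0 < ε → ∃ k : C_c(Space d, ℂ), ∀ x,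
      ‖𝓕⁻ (k : Space d → ℂ) x * conj (𝓕⁻ (g : Space d → ℂ) x) - φ x‖ ≤
        ε * ‖𝓕⁻ (g : Space d → ℂ) x‖ ^ 2 := by
  obtain ⟨g, hg⟩ := exists_fourierInv_ne_zero φ.hasCompactSupport
  have hgc : Continuous (𝓕⁻ (g : Space d → ℂ)) := continuous_fourierInv (integrable_volume g)
  set G : Space d → ℂ := 𝓕⁻ (g : Space d → ℂ) with hG
  have hsupp : Function.support (fun x => φ x / (G x * conj (G x))) ⊆ Function.support φ :=
    fun x hx h0 => hx (by simp [h0])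
  have hcont : Continuous fun x => φ x / (G x * conj (G x)) := by
    refine continuous_of_tsupport fun x hx => ?_
    have hx' := hg x (closure_mono hsupp hx)
    exact (map_continuous φ).continuousAt.div
      (hgc.mul (Complex.continuous_conj.comp hgc)).continuousAt (by simpa using hx')
  refine ⟨g, fun ε hε => ?_⟩
  obtain ⟨h, hh⟩ := exists_fourierInv_near
    ⟨⟨fun x => φ x / (G x * conj (G x)), hcont⟩, φ.hasCompactSupport.mono hsupp⟩ hε
  refine ⟨conv g h, fun x => ?_⟩
  have hx : ‖φ x / (G x * conj (G x)) - 𝓕⁻ (h : Space d → ℂ) x‖ ≤ ε := hh x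
  have e : φ x = φ x / (G x * conj (G x)) * (G x * conj (G x)) := by
    by_cases h0 : G x = 0
    · have : φ x = 0 := by
        by_contra hφ
        exact hg x (subset_tsupport φ hφ) h0
      simp [this]
    · rw [div_mul_cancel₀]
      simpa using h0
  rw [fourierInv_conv, ← hG, e, norm_sub_rev]
  have e2 : φ x / (G x * conj (G x)) * (G x * conj (G x)) -
      G x * 𝓕⁻ (h : Space d → ℂ) x * conj (G x) =
      (φ x / (G x * conj (G x)) - 𝓕⁻ (h : Space d → ℂ) x) * (G x * conj (G x)) := by ring
  rw [e2, norm_mul, norm_mul, RCLike.norm_conj, ← sq]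
  gcongr

lemma IsFourierTransform.norm_apply_sub_le {μ ν : RadonMeasure d} (hF : IsFourierTransform μ ν)
    {φ g k : C_c(Space d, ℂ)} {ε : ℝ}
    (h : ∀ x, ‖𝓕⁻ (k : Space d → ℂ) x * conj (𝓕⁻ (g : Space d → ℂ) x) - φ x‖ ≤
        ε * ‖𝓕⁻ (g : Space d → ℂ) x‖ ^ 2) :
    ‖ν φ - μ (conv k (tilde g))‖ ≤
      ε * ∫ x, ‖𝓕⁻ (g : Space d → ℂ) x‖ ^ 2 ∂ν.totalVariation := by
  have hk := hF.hasIntegral_mul_conj k g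
  refine (hk.norm_sub_le φ).trans ?_
  rw [← integral_const_mul]
  have i₁ : Integrable (fun x => ‖𝓕⁻ (k : Space d → ℂ) x * conj (𝓕⁻ (g : Space d → ℂ) x) - φ x‖)
      ν.totalVariation := (hk.1.sub (ν.integrable_totalVariation φ)).norm
  have i₂ : Integrable (fun x => ‖𝓕⁻ (g : Space d → ℂ) x‖ ^ 2) ν.totalVariation :=
    (hF g).1.integrable_norm_pow two_ne_zero
  exact integral_mono i₁ (i₂.const_mul ε) h

/-- The approximating value μ(k * g̃) involves neither ν₁ nor ν₂, and both ν₁(φ) and ν₂(φ) are close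
to it. -/
lemma IsFourierTransform.eq_apply {μ ν₁ ν₂ : RadonMeasure d} (h₁ : IsFourierTransform μ ν₁)
    (h₂ : IsFourierTransform μ ν₂) (φ : C_c(Space d, ℂ)) : ν₁ φ = ν₂ φ := by
  obtain ⟨g, hg⟩ := exists_fourierInv_mul_conj_near φ
  obtain ⟨a, ha'⟩ : ∃ a, a = ∫ x, ‖𝓕⁻ (g : Space d → ℂ) x‖ ^ 2 ∂ν₁.totalVariation := ⟨_, rfl⟩
  obtain ⟨b, hb'⟩ : ∃ b, b = ∫ x, ‖𝓕⁻ (g : Space d → ℂ) x‖ ^ 2 ∂ν₂.totalVariation := ⟨_, rfl⟩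
  have ha : 0 ≤ a := ha' ▸ integral_nonneg fun _ => sq_nonneg _
  have hb : 0 ≤ b := hb' ▸ integral_nonneg fun _ => sq_nonneg _
  rw [← sub_eq_zero, ← norm_le_zero_iff]
  refine le_of_forall_pos_le_add fun ε hε => ?_
  have hpos : 0 < a + b + 1 := by positivity
  obtain ⟨k, hk⟩ := hg (ε / (a + b + 1)) (div_pos hε hpos)
  have e₁ := h₁.norm_apply_sub_le hk
  have e₂ := h₂.norm_apply_sub_le hk
  rw [← ha'] at e₁
  rw [← hb'] at e₂
  have e₃ : ε / (a + b + 1) * a + ε / (a + b + 1) * b ≤ ε := by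
    rw [← mul_add, div_mul_eq_mul_div, div_le_iff₀ hpos]
    nlinarith
  rw [norm_sub_rev] at e₂
  linarith [norm_sub_le_norm_sub_add_norm_sub (ν₁ φ) (μ (conv k (tilde g))) (ν₂ φ)]

/-! ### Square integrability of ǧ. -/

lemma lintegral_enorm_sq_schwartzMap (s : 𝓢(Space d, ℂ)) :
    ∫⁻ x, ‖s x‖ₑ ^ 2 = ENNReal.ofReal (∫ x, ‖s x‖ ^ 2) := by
  rw [ofReal_integral_eq_lintegral_ofReal ((s.memLp 2 volume).integrable_norm_pow two_ne_zero)
    (ae_of_all _ fun _ => by positivity)]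
  simp_rw [ENNReal.ofReal_pow (norm_nonneg _), ofReal_norm]

lemma lintegral_enorm_sq_fourierInv_schwartzMap (s : 𝓢(Space d, ℂ)) :
    ∫⁻ x, ‖𝓕⁻ (s : Space d → ℂ) x‖ₑ ^ 2 = ∫⁻ x, ‖s x‖ₑ ^ 2 := by
  rw [← SchwartzMap.fourierInv_coe, lintegral_enorm_sq_schwartzMap,
    lintegral_enorm_sq_schwartzMap, ← SchwartzMap.integral_norm_sq_fourier]
  simp

/-- The inverse Fourier transform of a function in `C_c(ℝ^d)` is square integrable. -/
lemma lintegral_fourierInv_sq_ne_top (g : C_c(Space d, ℂ)) :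
    ∫⁻ x, ‖𝓕⁻ (g : Space d → ℂ) x‖ₑ ^ 2 ≠ ∞ := by
  -- Plancherel for Schwartz approximants supported in supp g bounds their transforms in L²
  -- uniformly; Fatou carries the bound to ǧ.
  choose s hs hsupp using fun n : ℕ =>
    exists_schwartzMap_near g (ε := 1 / ((n : ℝ) + 1)) Nat.one_div_pos_of_nat
  have hK : IsCompact (tsupport g) := g.hasCompactSupport
  have hKm : MeasurableSet (tsupport g) := (isClosed_tsupport g).measurableSet
  have hzero : ∀ n x, x ∉ tsupport g → s n x = 0 := fun n x hx => by
    by_contra h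
    exact hx (subset_tsupport g (hsupp n h))
  obtain ⟨M, hM⟩ := g.hasCompactSupport.exists_bound_of_continuous (map_continuous g)
  have hbound : ∀ n, ∫⁻ x, ‖𝓕⁻ (s n : Space d → ℂ) x‖ₑ ^ 2 ≤
      ENNReal.ofReal (M + 1) ^ 2 * volume (tsupport g) := fun n => by
    rw [lintegral_enorm_sq_fourierInv_schwartzMap, ← lintegral_indicator_const hKm]
    refine lintegral_mono fun x => ?_
    by_cases hx : x ∈ tsupport g
    · rw [Set.indicator_of_mem hx, ← ofReal_norm]
      gcongr
      have h1 : 1 / ((n : ℝ) + 1) ≤ 1 := by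
        rw [div_le_one (by positivity)]
        linarith [(n.cast_nonneg : (0 : ℝ) ≤ n)]
      linarith [norm_le_norm_add_norm_sub' (s n x) (g x), hs n x, hM x]
    · rw [hzero n x hx]
      simp
  have hlim : ∀ x, Tendsto (fun n => 𝓕⁻ (s n : Space d → ℂ) x) atTop
      (𝓝 (𝓕⁻ (g : Space d → ℂ) x)) := fun x => by
    rw [tendsto_iff_norm_sub_tendsto_zero]
    have h0 : Tendsto (fun n : ℕ => volume.real (tsupport g) * (1 / ((n : ℝ) + 1))) atTop
        (𝓝 0) := by
      simpa using tendsto_one_div_add_atTop_nhds_zero_nat.const_mul (volume.real (tsupport g))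
    refine squeeze_zero (fun _ => norm_nonneg _) (fun n => ?_) h0
    refine (norm_fourierInv_sub_le (s n).integrable (integrable_volume g) x).trans ?_
    rw [← smul_eq_mul, ← integral_indicator_const _ hKm]
    refine integral_mono_of_nonneg (ae_of_all _ fun _ => norm_nonneg _)
      ((integrable_indicator_iff hKm).2 (integrableOn_const hK.measure_lt_top.ne))
      (ae_of_all _ fun y => ?_)
    by_cases hy : y ∈ tsupport g
    · rw [Set.indicator_of_mem hy]
      exact hs n y
    · simp only [hzero n y hy, image_eq_zero_of_notMem_tsupport hy, Set.indicator_of_notMem hy]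
      simp
  have hF : ∀ n, Measurable fun x => ‖𝓕⁻ (s n : Space d → ℂ) x‖ₑ ^ 2 := fun n =>
    (continuous_fourierInv (s n).integrable).enorm.measurable.pow_const 2
  have hfat := lintegral_liminf_le (μ := volume) (u := atTop) hF
  have e : ∀ x, liminf (fun n => ‖𝓕⁻ (s n : Space d → ℂ) x‖ₑ ^ 2) atTop =
      ‖𝓕⁻ (g : Space d → ℂ) x‖ₑ ^ 2 := fun x =>
    (ENNReal.Tendsto.pow (hlim x).enorm).liminf_eq
  simp_rw [e] at hfat
  refine ((hfat.trans (liminf_le_of_frequently_le' (Frequently.of_forall hbound))).trans_lt ?_).ne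
  exact ENNReal.mul_lt_top (by simp) hK.measure_lt_top

/-! ### Domination of |ǧ|² on unit balls. -/

/-- The Cauchy-Schwarz inequality with a weight. -/
lemma sq_lintegral_mul_le {α : Type*} [MeasurableSpace α] {m : Measure α} {w f : α → ℝ≥0∞}
    (hw : Measurable w) (hf : Measurable f) :
    (∫⁻ x, w x * f x ∂m) ^ 2 ≤ (∫⁻ x, w x ∂m) * ∫⁻ x, w x * f x ^ 2 ∂m := by
  have h2 : (2 : ℝ).HolderConjugate 2 := Real.HolderConjugate.two_two
  have h := ENNReal.lintegral_mul_le_Lp_mul_Lq m h2 (f := fun x => w x ^ (1 / 2 : ℝ))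
    (g := fun x => w x ^ (1 / 2 : ℝ) * f x) (hw.pow_const _).aemeasurable
    ((hw.pow_const _).mul hf).aemeasurable
  have e1 : ∀ a : ℝ≥0∞, (a ^ (1 / 2 : ℝ)) ^ (2 : ℝ) = a := fun a => by
    rw [← ENNReal.rpow_mul]
    norm_num
  have e2 : ∀ a : ℝ≥0∞, a ^ (1 / 2 : ℝ) * a ^ (1 / 2 : ℝ) = a := fun a => by
    have := e1 a
    rwa [ENNReal.rpow_two, sq] at this
  simp only [Pi.mul_apply, ← mul_assoc, e2] at h
  simp only [ENNReal.mul_rpow_of_nonneg _ _ zero_le_two, e1] at h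
  calc (∫⁻ x, w x * f x ∂m) ^ 2 ≤ _ := pow_le_pow_left₀ zero_le h 2
    _ = _ := by
      rw [← ENNReal.rpow_two, ENNReal.mul_rpow_of_nonneg _ _ zero_le_two, e1, e1]
      simp only [ENNReal.rpow_two]

/-- The integrable weight `(1 + ‖x‖)^{-(d + 1)}`. -/
noncomputable def weight (x : Space d) : ℝ≥0∞ := ENNReal.ofReal ((1 + ‖x‖) ^ (-((d : ℝ) + 1)))

lemma measurable_weight : Measurable (weight (d := d)) := by
  unfold weight
  fun_prop

lemma lintegral_weight_ne_top : ∫⁻ x : Space d, weight x ≠ ∞ :=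
  (finite_integral_one_add_norm (by simp)).ne

/-- Here 1 + ‖y‖ ≤ 2 + ‖x‖ ≤ 2(1 + ‖x‖). This slow variation lets a bound at x be moved to any z in
its unit ball. -/
lemma weight_le {x y : Space d} (h : ‖x - y‖ ≤ 1) : weight x ≤ 2 ^ (d + 1) * weight y := by
  have e : ∀ x : Space d, (1 + ‖x‖) ^ (-((d : ℝ) + 1)) = ((1 + ‖x‖) ^ (d + 1))⁻¹ := fun x => by
    rw [Real.rpow_neg (by positivity)]
    norm_cast
  have h2 : (2 : ℝ≥0∞) ^ (d + 1) = ENNReal.ofReal (2 ^ (d + 1)) := by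
    rw [ENNReal.ofReal_pow zero_le_two]
    simp
  rw [weight, weight, e, e, h2, ← ENNReal.ofReal_mul (by positivity)]
  apply ENNReal.ofReal_le_ofReal
  rw [← div_eq_mul_inv, inv_le_comm₀ (by positivity) (by positivity), inv_div, ← div_pow]
  gcongr
  rw [div_le_iff₀ zero_lt_two]
  linarith [norm_le_norm_add_norm_sub x y, norm_nonneg x]

lemma exists_enorm_le_weight (η : 𝓢(Space d, ℂ)) :
    ∃ C : ℝ≥0∞, C ≠ ∞ ∧ ∀ x, ‖η x‖ₑ ≤ C * weight x := by
  refine ⟨ENNReal.ofReal (2 ^ (d + 1) * (Finset.Iic (d + 1, 0)).sup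
    (fun m => SchwartzMap.seminorm ℂ m.1 m.2) η), ENNReal.ofReal_ne_top, fun x => ?_⟩
  have h := SchwartzMap.one_add_le_sup_seminorm_apply (𝕜 := ℂ) (m := (d + 1, 0)) le_rfl le_rfl η x
  rw [norm_iteratedFDeriv_zero] at h
  rw [weight, ← ENNReal.ofReal_mul (by positivity), ← ofReal_norm]
  apply ENNReal.ofReal_le_ofReal
  rw [Real.rpow_neg (by positivity), ← div_eq_mul_inv, le_div_iff₀ (by positivity), mul_comm]
  exact_mod_cast h

/-- The inverse Fourier transform of `g ∈ C_c(ℝ^d)` reproduces under convolution with a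
Schwartz function. -/
lemma exists_schwartzMap_reproducing (g : C_c(Space d, ℂ)) : ∃ η : 𝓢(Space d, ℂ),
    ∀ x, 𝓕⁻ (g : Space d → ℂ) x = ∫ s, η s * 𝓕⁻ (g : Space d → ℂ) (x - s) := by
  obtain ⟨R, hR⟩ := g.hasCompactSupport.isBounded.subset_closedBall 0
  -- The bump is 1 on supp g, so ψg = g, and η is the inverse transform of ψ. R may be negative if g
  -- = 0, hence |R| + 1.
  let b : ContDiffBump (0 : Space d) := ⟨|R| + 1, |R| + 2, by positivity, by linarith⟩
  have hbc : HasCompactSupport fun x => (b x : ℂ) :=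
    b.hasCompactSupport.comp_left (g := fun r : ℝ => (r : ℂ)) rfl
  have hbs : ContDiff ℝ (⊤ : ℕ∞) fun x => (b x : ℂ) := Complex.ofRealCLM.contDiff.comp b.contDiff
  set ψ : 𝓢(Space d, ℂ) := hbc.toSchwartzMap hbs
  have hψ : ∀ x, ψ x * g x = g x := fun x => by
    by_cases hx : x ∈ tsupport g
    · have h1 : x ∈ Metric.closedBall 0 b.rIn :=
        Metric.closedBall_subset_closedBall (by change R ≤ |R| + 1; linarith [le_abs_self R])
          (hR hx)
      have : ψ x = 1 := by
        change ((b x : ℝ) : ℂ) = 1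
        rw [b.one_of_mem_closedBall h1]
        simp
      rw [this, one_mul]
    · rw [image_eq_zero_of_notMem_tsupport hx, mul_zero]
  refine ⟨𝓕⁻ ψ, fun x => ?_⟩
  have hG : Integrable fun t => Real.fourierChar (inner ℝ t x) • g t :=
    (((Real.continuous_fourierChar.comp (by fun_prop)).smul
      (map_continuous g)).integrable_of_hasCompactSupport g.hasCompactSupport.smul_left)
  -- Move the transform from η to g times a character: one side becomes ∫ ψg times that character,
  -- the other the convolution of η with ǧ.
  have h := VectorFourier.integral_fourierIntegral_smul_eq_flip (L := innerₗ (Space d))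
    Real.continuous_fourierChar continuous_inner ((𝓕⁻ ψ).integrable (μ := volume)) hG
  have e1 : ∀ ξ, VectorFourier.fourierIntegral Real.fourierChar volume (innerₗ (Space d))
      ((𝓕⁻ ψ : 𝓢(Space d, ℂ)) : Space d → ℂ) ξ = ψ ξ := fun ξ => by
    change (𝓕 (𝓕⁻ ψ : 𝓢(Space d, ℂ))) ξ = ψ ξ
    simp
  have e2 : ∀ s, VectorFourier.fourierIntegral Real.fourierChar volume (innerₗ (Space d)).flip
      (fun t => Real.fourierChar (inner ℝ t x) • g t) s = 𝓕⁻ (g : Space d → ℂ) (x - s) := fun s => by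
    rw [Real.fourierInv_eq, flip_innerₗ, VectorFourier.fourierIntegral]
    congr 1 with t
    rw [smul_smul, ← AddChar.map_add_eq_mul, innerₗ_apply_apply, inner_sub_right, neg_add_eq_sub]
  simp_rw [e1, e2, smul_eq_mul] at h
  rw [← h, Real.fourierInv_eq]
  congr 1 with t
  rw [mul_smul_comm, hψ]

/-- `|ǧ|²` is dominated on unit balls by an integrable function. -/
lemma exists_dominating (g : C_c(Space d, ℂ)) : ∃ P : Space d → ℝ≥0∞, Measurable P ∧
    ∫⁻ z, P z ≠ ∞ ∧ ∀ x z, ‖x - z‖ ≤ 1 → ‖𝓕⁻ (g : Space d → ℂ) x‖ₑ ^ 2 ≤ P z := by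
  obtain ⟨η, hη⟩ := exists_schwartzMap_reproducing g
  obtain ⟨C, hC, hηC⟩ := exists_enorm_le_weight η
  have hG : Measurable fun x => ‖𝓕⁻ (g : Space d → ℂ) x‖ₑ :=
    (continuous_fourierInv (integrable_volume g)).enorm.measurable
  have hL2 := lintegral_fourierInv_sq_ne_top g
  have hm : Measurable (Function.uncurry fun z y : Space d =>
      weight (z - y) * ‖𝓕⁻ (g : Space d → ℂ) y‖ₑ ^ 2) :=
    (measurable_weight.comp (measurable_fst.sub measurable_snd)).mul
      ((hG.comp measurable_snd).pow_const 2)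
  have hm' : Measurable fun z => ∫⁻ y, weight (z - y) * ‖𝓕⁻ (g : Space d → ℂ) y‖ₑ ^ 2 :=
    hm.lintegral_prod_right'
  set A := C ^ 2 * (∫⁻ s : Space d, weight s) * 2 ^ (d + 1) with hA
  have hA' : A ≠ ∞ := ENNReal.mul_ne_top (ENNReal.mul_ne_top (ENNReal.pow_ne_top hC)
    lintegral_weight_ne_top) (by simp)
  -- P is a multiple of the convolution of the weight with |ǧ|², both integrable. In A, C² comes
  -- from |η| ≤ C·weight, the integral from Cauchy-Schwarz and 2^(d+1) from replacing x by z.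
  refine ⟨fun z => A * ∫⁻ y, weight (z - y) * ‖𝓕⁻ (g : Space d → ℂ) y‖ₑ ^ 2,
    hm'.const_mul A, ?_, fun x z hxz => ?_⟩
  · change ∫⁻ z, A * ∫⁻ y, weight (z - y) * ‖𝓕⁻ (g : Space d → ℂ) y‖ₑ ^ 2 ≠ ∞
    rw [lintegral_const_mul _ hm',
      lintegral_lintegral_swap hm.aemeasurable]
    have : ∀ y : Space d, ∫⁻ z, weight (z - y) * ‖𝓕⁻ (g : Space d → ℂ) y‖ₑ ^ 2 =
        (∫⁻ z : Space d, weight z) * ‖𝓕⁻ (g : Space d → ℂ) y‖ₑ ^ 2 := fun y => by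
      have hw : Measurable fun z => weight (z - y) :=
        measurable_weight.comp (measurable_id.sub_const y)
      rw [lintegral_mul_const _ hw,
        lintegral_sub_right_eq_self weight y]
    simp_rw [this]
    rw [lintegral_const_mul _ (hG.pow_const 2)]
    exact ENNReal.mul_ne_top hA' (ENNReal.mul_ne_top lintegral_weight_ne_top hL2)
  · have h1 : ‖𝓕⁻ (g : Space d → ℂ) x‖ₑ ≤
        C * ∫⁻ s, weight s * ‖𝓕⁻ (g : Space d → ℂ) (x - s)‖ₑ := by
      rw [hη x, ← lintegral_const_mul' _ _ hC]
      refine (enorm_integral_le_lintegral_enorm _).trans (lintegral_mono fun s => ?_)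
      rw [enorm_mul, ← mul_assoc]
      gcongr
      exact hηC s
    have h2 := sq_lintegral_mul_le (m := volume) measurable_weight
      (hG.comp (measurable_id.const_sub x))
    have h3 : ∫⁻ s, weight s * ‖𝓕⁻ (g : Space d → ℂ) (x - s)‖ₑ ^ 2 ≤
        2 ^ (d + 1) * ∫⁻ y, weight (z - y) * ‖𝓕⁻ (g : Space d → ℂ) y‖ₑ ^ 2 := by
      rw [← lintegral_sub_left_eq_self _ x, ← lintegral_const_mul' _ _ (by simp)]
      refine lintegral_mono fun y => ?_
      rw [sub_sub_cancel, ← mul_assoc]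
      gcongr
      apply weight_le
      rwa [sub_sub_sub_cancel_right]
    calc ‖𝓕⁻ (g : Space d → ℂ) x‖ₑ ^ 2
        ≤ (C * ∫⁻ s, weight s * ‖𝓕⁻ (g : Space d → ℂ) (x - s)‖ₑ) ^ 2 := by gcongr
      _ = C ^ 2 * (∫⁻ s, weight s * ‖𝓕⁻ (g : Space d → ℂ) (x - s)‖ₑ) ^ 2 := mul_pow _ _ _
      _ ≤ C ^ 2 * ((∫⁻ s : Space d, weight s) * (2 ^ (d + 1) *
          ∫⁻ y, weight (z - y) * ‖𝓕⁻ (g : Space d → ℂ) y‖ₑ ^ 2)) := by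
        gcongr
        exact h2.trans (by gcongr; exact h3)
      _ = _ := by rw [hA]; ring

/-! ### Uniform integral bounds for translation bounded measures. -/

/-- Tonelli on the pairs (x, z) at distance at most 1: integrating P(z) in z first gives at least
the ball volume times h(x), and integrating in x first costs at most M per z. -/
lemma volume_mul_lintegral_le {m : Measure (Space d)} [SFinite m] {M : ℝ≥0∞}
    (hM : ∀ t, m (Metric.closedBall t 1) ≤ M) {h P : Space d → ℝ≥0∞} (hP : Measurable P)
    (hhP : ∀ x z, ‖x - z‖ ≤ 1 → h x ≤ P z) :
    volume (Metric.closedBall (0 : Space d) 1) * ∫⁻ x, h x ∂m ≤ M * ∫⁻ z, P z := by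
  set V := volume (Metric.closedBall (0 : Space d) 1)
  have hV : V ≠ ∞ := measure_closedBall_lt_top.ne
  have hS : MeasurableSet {p : Space d × Space d | dist p.2 p.1 ≤ 1} :=
    (isClosed_le (by fun_prop) continuous_const).measurableSet
  have hm : Measurable (Function.uncurry fun x z : Space d =>
      (Metric.closedBall x 1).indicator P z) :=
    (hP.comp measurable_snd).indicator hS
  have hsymm : ∀ x z : Space d, (Metric.closedBall x 1).indicator P z =
      (Metric.closedBall z 1).indicator (fun _ => P z) x := fun x z => by
    simp only [Set.indicator, Metric.mem_closedBall, dist_comm]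
  calc V * ∫⁻ x, h x ∂m = ∫⁻ x, V * h x ∂m := (lintegral_const_mul' _ _ hV).symm
    _ ≤ ∫⁻ x, (∫⁻ z, (Metric.closedBall x 1).indicator P z) ∂m := by
      refine lintegral_mono fun x => ?_
      have hVx : V = volume (Metric.closedBall x 1) :=
        (Measure.addHaar_closedBall_center volume x 1).symm
      rw [lintegral_indicator measurableSet_closedBall, mul_comm, hVx, ← setLIntegral_const]
      refine setLIntegral_mono hP fun z hz => hhP x z ?_
      rw [← dist_eq_norm, dist_comm]
      exact hz
    _ = ∫⁻ z, ∫⁻ x, (Metric.closedBall x 1).indicator P z ∂m :=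
      lintegral_lintegral_swap hm.aemeasurable
    _ ≤ ∫⁻ z, M * P z := by
      refine lintegral_mono fun z => ?_
      simp_rw [hsymm]
      rw [lintegral_indicator_const measurableSet_closedBall, mul_comm]
      gcongr
      exact hM z
    _ = M * ∫⁻ z, P z := lintegral_const_mul _ hP

lemma lintegral_le_of_dominated {m : Measure (Space d)} [SFinite m] {M : ℝ≥0∞}
    (hM : ∀ t, m (Metric.closedBall t 1) ≤ M) {h P : Space d → ℝ≥0∞} (hP : Measurable P)
    (hhP : ∀ x z, ‖x - z‖ ≤ 1 → h x ≤ P z) :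
    ∫⁻ x, h x ∂m ≤ (volume (Metric.closedBall (0 : Space d) 1))⁻¹ * M * ∫⁻ z, P z := by
  have hV : volume (Metric.closedBall (0 : Space d) 1) ≠ ∞ := measure_closedBall_lt_top.ne
  have hV0 : volume (Metric.closedBall (0 : Space d) 1) ≠ 0 :=
    (Metric.measure_closedBall_pos _ _ one_pos).ne'
  have h2 := volume_mul_lintegral_le hM hP hhP
  calc ∫⁻ x, h x ∂m = (volume (Metric.closedBall (0 : Space d) 1))⁻¹ *
        (volume (Metric.closedBall (0 : Space d) 1) * ∫⁻ x, h x ∂m) := by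
        rw [← mul_assoc, ENNReal.inv_mul_cancel hV0 hV, one_mul]
    _ ≤ _ := by
        rw [mul_assoc]
        gcongr

lemma inv_volume_closedBall_mul_ne_top {M : ℝ≥0∞} (hM : M ≠ ∞) :
    (volume (Metric.closedBall (0 : Space d) 1))⁻¹ * M ≠ ∞ :=
  ENNReal.mul_ne_top (ENNReal.inv_ne_top.2 (Metric.measure_closedBall_pos _ _ one_pos).ne') hM

/-- S depends on m only through M, so it serves a whole sequence and its limit. -/
lemma exists_lintegral_fourierInv_sq_le (g : C_c(Space d, ℂ)) {M : ℝ≥0∞} (hM : M ≠ ∞) :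
    ∃ S : ℝ≥0∞, S ≠ ∞ ∧ ∀ (m : Measure (Space d)) [SFinite m],
      (∀ t, m (Metric.closedBall t 1) ≤ M) →
        ∫⁻ x, ‖𝓕⁻ (g : Space d → ℂ) x‖ₑ ^ 2 ∂m ≤ S := by
  obtain ⟨P, hP, hPi, hgP⟩ := exists_dominating g
  exact ⟨_, ENNReal.mul_ne_top (inv_volume_closedBall_mul_ne_top hM) hPi,
    fun m _ hm => lintegral_le_of_dominated hm hP hgP⟩

/-- Uniform smallness of the tails of `|ǧ|²` for uniformly translation bounded measures. -/
lemma exists_cutoff_lintegral_le (g : C_c(Space d, ℂ)) {M δ : ℝ≥0∞} (hM : M ≠ ∞) (hδ : 0 < δ) :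
    ∃ χ : C_c(Space d, ℂ), ∀ (m : Measure (Space d)) [SFinite m],
      (∀ t, m (Metric.closedBall t 1) ≤ M) →
        ∫⁻ x, ‖𝓕⁻ (g : Space d → ℂ) x‖ₑ ^ 2 * ‖1 - χ x‖ₑ ∂m ≤ δ := by
  obtain ⟨P, hP, hPi, hgP⟩ := exists_dominating g
  have hA := inv_volume_closedBall_mul_ne_top (d := d) hM
  have hset : ∀ n : ℕ, MeasurableSet {z : Space d | (n : ℝ) < ‖z‖} := fun n =>
    (isOpen_lt continuous_const continuous_norm).measurableSet
  have hlim : Tendsto (fun n : ℕ => ∫⁻ z, {z : Space d | (n : ℝ) < ‖z‖}.indicator P z) atTop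
      (𝓝 0) := by
    rw [← lintegral_zero (μ := (volume : Measure (Space d)))]
    refine tendsto_lintegral_of_dominated_convergence P (fun n => hP.indicator (hset n))
      (fun n => ae_of_all _ fun z => Set.indicator_le_self _ _ _) hPi (ae_of_all _ fun z => ?_)
    obtain ⟨N, hN⟩ := exists_nat_ge ‖z‖
    refine tendsto_const_nhds.congr' ?_
    filter_upwards [eventually_ge_atTop N] with n hn
    rw [Set.indicator_of_notMem]
    simpa using hN.trans (Nat.cast_le.2 hn)
  have hlim2 := ENNReal.Tendsto.const_mul hlim (Or.inr hA)
  rw [mul_zero] at hlim2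
  obtain ⟨n, hn⟩ := (hlim2.eventually_le_const hδ).exists
  -- Radius n + 1, because a point z within 1 of some x outside this ball still has ‖z‖ > n.
  obtain ⟨χ, h1, h2⟩ := exists_cutoff (isCompact_closedBall (0 : Space d) (n + 1))
  refine ⟨χ, fun m _ hm => (lintegral_le_of_dominated hm (hP.indicator (hset n))
    fun x z hxz => ?_).trans hn⟩
  by_cases hx : x ∈ Metric.closedBall (0 : Space d) (n + 1)
  · simp [h1 x hx]
  · rw [mem_closedBall_zero_iff, not_le] at hx
    have hz : z ∈ {z : Space d | (n : ℝ) < ‖z‖} := by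
      change (n : ℝ) < ‖z‖
      linarith [norm_le_norm_add_norm_sub z x, norm_sub_rev x z]
    rw [Set.indicator_of_mem hz]
    have h3 : ‖1 - χ x‖ₑ ≤ 1 := by
      rw [← ofReal_norm, ← ENNReal.ofReal_one]
      exact ENNReal.ofReal_le_ofReal (h2 x).2
    calc _ ≤ ‖𝓕⁻ (g : Space d → ℂ) x‖ₑ ^ 2 * 1 := by gcongr
      _ ≤ P z := by
        rw [mul_one]
        exact hgP x z hxz

/-! ### Vague limits of translation bounded measures. -/

namespace RadonMeasure

lemma norm_apply_le_mul (ν : RadonMeasure d) {g : C_c(Space d, ℂ)} {A : ℝ}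
    (hA : ∀ x, ‖g x‖ ≤ A) {t : Space d} {r : ℝ}
    (hg : tsupport g ⊆ Metric.closedBall t r) {M : ℝ≥0∞} (hM : M ≠ ∞)
    (hν : ν.totalVariation (Metric.closedBall t r) ≤ M) : ‖ν g‖ ≤ M.toReal * A := by
  have hA0 : 0 ≤ A := (norm_nonneg _).trans (hA 0)
  have hfin : ν.totalVariation (Metric.closedBall t r) ≠ ∞ := ne_top_of_le_ne_top hM hν
  calc ‖ν g‖ ≤ ∫ x, ‖g x‖ ∂ν.totalVariation := ν.norm_apply_le_integral g
    _ ≤ ∫ x, (Metric.closedBall t r).indicator (fun _ => A) x ∂ν.totalVariation := by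
      refine integral_mono (ν.integrable_totalVariation g).norm
        ((integrable_indicator_iff measurableSet_closedBall).2 (integrableOn_const hfin))
        fun x => ?_
      by_cases hx : x ∈ Metric.closedBall t r
      · rw [Set.indicator_of_mem hx]
        exact hA x
      · rw [Set.indicator_of_notMem hx, image_eq_zero_of_notMem_tsupport fun h => hx (hg h),
          norm_zero]
    _ = ν.totalVariation.real (Metric.closedBall t r) * A := by
      rw [integral_indicator_const _ measurableSet_closedBall, smul_eq_mul]
    _ ≤ M.toReal * A := by
      gcongr
      exact ENNReal.toReal_mono hM hν

/-- A pointwise convergent sequence of uniformly translation bounded measures has a vague limit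
that is translation bounded. -/
lemma exists_vagueTendsto {ν : ℕ → RadonMeasure d} {M : ℝ → ℝ≥0∞} (hM : ∀ r, M r ≠ ∞)
    (hν : ∀ r n t, (ν n).totalVariation (Metric.closedBall t r) ≤ M r)
    (hlim : ∀ φ : C_c(Space d, ℂ), ∃ l, Tendsto (fun n => ν n φ) atTop (𝓝 l)) :
    ∃ ν' : RadonMeasure d, VagueTendsto ν ν' ∧
      ∀ t, ν'.totalVariation (Metric.closedBall t 1) ≤ M 2 := by
  choose l hl using hlim
  have hbound : ∀ (g : C_c(Space d, ℂ)) (A : ℝ), (∀ x, ‖g x‖ ≤ A) → ∀ (t : Space d) (r : ℝ),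
      tsupport g ⊆ Metric.closedBall t r → ‖l g‖ ≤ (M r).toReal * A := fun g A hA t r hg =>
    le_of_tendsto (hl g).norm (Eventually.of_forall fun n =>
      (ν n).norm_apply_le_mul hA hg (hM r) (hν r n t))
  let ν' : RadonMeasure d :=
    { toLinearMap :=
        { toFun := l
          map_add' := fun f g => tendsto_nhds_unique (hl (f + g))
            (by simpa using (hl f).add (hl g))
          map_smul' := fun a f => tendsto_nhds_unique (hl (a • f))
            (by simpa using (hl f).const_mul a) }
      bounded := fun K hK => by
        obtain ⟨r, hr⟩ := hK.isBounded.subset_closedBall 0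
        refine ⟨(M r).toReal + 1, by positivity, fun g hg => ?_⟩
        have hb : BddAbove (Set.range fun x => ‖g x‖) := by
          obtain ⟨A, hA⟩ := g.hasCompactSupport.exists_bound_of_continuous (map_continuous g)
          exact ⟨A, by rintro _ ⟨x, rfl⟩; exact hA x⟩
        refine (hbound g _ (fun x => le_ciSup hb x) 0 r (hg.trans hr)).trans ?_
        exact mul_le_mul_of_nonneg_right (by linarith) (Real.iSup_nonneg fun _ => norm_nonneg _) }
  refine ⟨ν', hl, fun t => ?_⟩
  -- The mass of a unit ball is tested by a continuous function living on the ball of radius 2,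
  -- which is why the limit is bounded by `M 2`.
  obtain ⟨f, h1, h0, hc, hf⟩ := exists_continuous_one_zero_of_isCompact
    (isCompact_closedBall t 1) (Metric.isOpen_ball (x := t) (ε := 2)).isClosed_compl
    (Set.disjoint_compl_right_iff_subset.2 (Metric.closedBall_subset_ball one_lt_two))
  let F : C_c(Space d, ℝ≥0) := ⟨⟨fun x => (f x).toNNReal, by fun_prop⟩,
    hc.comp_left (g := Real.toNNReal) Real.toNNReal_zero⟩
  have hF1 : ∀ x, F x ≤ 1 := fun x => Real.toNNReal_le_one.2 (hf x).2
  have hF0 : ∀ x, x ∉ Metric.ball t 2 → F x = 0 := fun x hx => by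
    change (f x).toNNReal = 0
    rw [h0 hx]
    simp
  have hvar : ν'.variation F ≤ (M 2).toNNReal := by
    refine ν'.variation_le F _ fun g hg => ?_
    rw [← NNReal.coe_le_coe]
    have hsupp : tsupport g ⊆ Metric.closedBall t 2 := by
      refine closure_minimal (fun x hx => ?_) Metric.isClosed_closedBall
      by_contra hx2
      have h3 := hg x
      rw [hF0 x fun h => hx2 (Metric.ball_subset_closedBall h)] at h3
      exact hx (by simpa using h3)
    have h4 := hbound g 1 (fun x => by exact_mod_cast (hg x).trans (hF1 x)) t 2 hsupp
    rw [mul_one] at h4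
    exact h4
  calc ν'.totalVariation (Metric.closedBall t 1)
      = ∫⁻ x, (Metric.closedBall t 1).indicator (fun _ => 1) x ∂ν'.totalVariation := by
        rw [lintegral_indicator_const measurableSet_closedBall, one_mul]
    _ ≤ ∫⁻ x, F x ∂ν'.totalVariation := by
        refine lintegral_mono fun x => ?_
        by_cases hx : x ∈ Metric.closedBall t 1
        · rw [Set.indicator_of_mem hx]
          have : F x = 1 := by
            change (f x).toNNReal = 1
            rw [h1 hx]
            simp
          simp [this]
        · rw [Set.indicator_of_notMem hx]
          exact zero_le
    _ = ν'.variation F := NNRealRMK.lintegral_rieszMeasure ν'.variationLinearMap F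
    _ ≤ (M 2).toNNReal := by exact_mod_cast hvar
    _ = M 2 := ENNReal.coe_toNNReal (hM 2)

lemma EquiTranslationBounded.exists_bound {ν : ℕ → RadonMeasure d}
    (h : EquiTranslationBounded ν) : ∃ M : ℝ → ℝ≥0∞, (∀ r, M r ≠ ∞) ∧
      ∀ r n t, (ν n).totalVariation (Metric.closedBall t r) ≤ M r := by
  refine ⟨fun r => ⨆ n, (ν n).translationNorm (Metric.closedBall 0 r),
    fun r => (h _ (isCompact_closedBall 0 r)).ne, fun r n t => ?_⟩
  have e : (fun x => t + x) '' Metric.closedBall 0 r = Metric.closedBall t r := by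
    simp
  rw [← e]
  exact (le_iSup (fun t => (ν n).totalVariation ((fun x => t + x) '' Metric.closedBall 0 r)) t).trans
    (le_iSup (fun n => (ν n).translationNorm (Metric.closedBall 0 r)) n)

lemma integral_norm_sub_mul_le (ν : RadonMeasure d) {f χ : C_c(Space d, ℂ)} {δ : ℝ}
    (hδ : 0 ≤ δ)
    (h : ∫⁻ x, ‖𝓕⁻ (f : Space d → ℂ) x‖ₑ ^ 2 * ‖1 - χ x‖ₑ ∂ν.totalVariation ≤
      ENNReal.ofReal δ) :
    ∫ x, ‖((‖𝓕⁻ (f : Space d → ℂ) x‖ ^ 2 : ℝ) : ℂ) -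
      ((‖𝓕⁻ (f : Space d → ℂ) x‖ ^ 2 : ℝ) : ℂ) * χ x‖ ∂ν.totalVariation ≤ δ := by
  have hc := continuous_fourierInv (integrable_volume f)
  rw [integral_norm_eq_lintegral_enorm (by fun_prop)]
  refine ENNReal.toReal_le_of_le_ofReal hδ (le_trans (le_of_eq ?_) h)
  congr 1 with x
  rw [← mul_one_sub, enorm_mul]
  congr 1
  rw [← ofReal_norm, Complex.norm_real, Real.norm_of_nonneg (by positivity),
    ENNReal.ofReal_pow (norm_nonneg _), ofReal_norm]

end RadonMeasure

/-! ### Convergence of the transforms and identification of the limit. -/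

/-- Under equi translation boundedness of the Fourier transforms, vague convergence of the
measures gives pointwise convergence of the Fourier transforms. -/
lemma exists_tendsto_apply {μ μhat : ℕ → RadonMeasure d} {μ' : RadonMeasure d}
    (hF : ∀ n, IsFourierTransform (μ n) (μhat n)) (hconv : RadonMeasure.VagueTendsto μ μ')
    {M : ℝ≥0∞} (hM : M ≠ ∞)
    (hbdd : ∀ n t, (μhat n).totalVariation (Metric.closedBall t 1) ≤ M) (φ : C_c(Space d, ℂ)) :
    ∃ l, Tendsto (fun n => μhat n φ) atTop (𝓝 l) := by
  obtain ⟨g, hg⟩ := exists_fourierInv_mul_conj_near φ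
  obtain ⟨S, hS, hgS⟩ := exists_lintegral_fourierInv_sq_le g hM
  have hint : ∀ n, ∫ x, ‖𝓕⁻ (g : Space d → ℂ) x‖ ^ 2 ∂(μhat n).totalVariation ≤ S.toReal :=
    fun n => by
      rw [integral_eq_lintegral_of_nonneg_ae (ae_of_all _ fun _ => sq_nonneg _)
        (((continuous_fourierInv (integrable_volume g)).norm.pow 2).aestronglyMeasurable)]
      refine ENNReal.toReal_mono hS (le_trans (le_of_eq ?_) (hgS _ (hbdd n)))
      simp_rw [ENNReal.ofReal_pow (norm_nonneg _), ofReal_norm]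
  refine cauchySeq_tendsto_of_complete (Metric.cauchySeq_iff.2 fun ε hε => ?_)
  have hpos : 0 < 3 * (S.toReal + 1) := by positivity
  -- One k for all n: the error is at most εS/(3(S + 1)) < ε/3, leaving ε/3 for the Cauchy property
  -- of μ_n(k * g̃).
  obtain ⟨k, hk⟩ := hg (ε / (3 * (S.toReal + 1))) (div_pos hε hpos)
  have hle : ∀ n, ‖μhat n φ - μ n (conv k (tilde g))‖ < ε / 3 := fun n => by
    refine ((hF n).norm_apply_sub_le hk).trans_lt ?_
    refine (mul_le_mul_of_nonneg_left (hint n) (div_pos hε hpos).le).trans_lt ?_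
    rw [div_mul_eq_mul_div, div_lt_div_iff₀ hpos three_pos]
    nlinarith
  obtain ⟨N, hN⟩ := Metric.cauchySeq_iff.1 (hconv (conv k (tilde g))).cauchySeq (ε / 3)
    (by positivity)
  refine ⟨N, fun a ha b hb => ?_⟩
  have h1 := hle a
  have h2 := hle b
  have h3 := hN a ha b hb
  rw [dist_eq_norm] at h3 ⊢
  rw [norm_sub_rev] at h2
  linarith [norm_sub_le_norm_sub_add_norm_sub (μhat a φ) (μ a (conv k (tilde g))) (μhat b φ),
    norm_sub_le_norm_sub_add_norm_sub (μ a (conv k (tilde g))) (μ b (conv k (tilde g)))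
      (μhat b φ)]

/-- Vague limits of uniformly translation bounded Fourier transforms are Fourier transforms. -/
lemma isFourierTransform_of_vagueTendsto {μ μhat : ℕ → RadonMeasure d} {μ' ν : RadonMeasure d}
    (hF : ∀ n, IsFourierTransform (μ n) (μhat n)) (hconv : RadonMeasure.VagueTendsto μ μ')
    (hconv' : RadonMeasure.VagueTendsto μhat ν) {M : ℝ≥0∞} (hM : M ≠ ∞)
    (hbdd : ∀ n t, (μhat n).totalVariation (Metric.closedBall t 1) ≤ M)
    (hν : ∀ t, ν.totalVariation (Metric.closedBall t 1) ≤ M) : IsFourierTransform μ' ν := by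
  intro f
  have hc := continuous_fourierInv (integrable_volume f)
  obtain ⟨S, hS, hfS⟩ := exists_lintegral_fourierInv_sq_le f hM
  have hmem : MemLp (𝓕⁻ (f : Space d → ℂ)) 2 ν.totalVariation := by
    refine ⟨hc.aestronglyMeasurable, ?_⟩
    rw [eLpNorm_lt_top_iff_lintegral_rpow_enorm_lt_top two_ne_zero ENNReal.ofNat_ne_top]
    simpa using (hfS _ hν).trans_lt hS.lt_top
  refine ⟨hmem, (hmem.integrable_norm_pow two_ne_zero).ofReal, fun ε hε => ?_⟩
  -- The same χ works for ν and for every `μhat n`, so the cut-off |f̌|² satisfies the required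
  -- inequality at each n, and it survives the limit.
  obtain ⟨χ, hχ⟩ := exists_cutoff_lintegral_le f hM (ENNReal.ofReal_pos.2 hε)
  let g : C_c(Space d, ℂ) := ⟨⟨fun x => ((‖𝓕⁻ (f : Space d → ℂ) x‖ ^ 2 : ℝ) : ℂ) * χ x,
    by fun_prop⟩, χ.hasCompactSupport.mul_left⟩
  refine ⟨g, ν.integral_norm_sub_mul_le hε.le (hχ _ hν), ?_⟩
  refine le_of_tendsto ((hconv' g).sub (hconv (conv f (tilde f)))).norm
    (Eventually.of_forall fun n => ?_)
  exact ((hF n f).2.norm_sub_le g).trans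
    ((μhat n).integral_norm_sub_mul_le hε.le (hχ _ (hbdd n)))

end FourierMeasure

theorem theoremT3 (d : ℕ) (μ μhat : ℕ → FourierMeasure.RadonMeasure d)
    (μ' : FourierMeasure.RadonMeasure d)
    (hF : ∀ n, FourierMeasure.IsFourierTransform (μ n) (μhat n))
    (hconv : FourierMeasure.RadonMeasure.VagueTendsto μ μ')
    (htemp : μ'.IsTempered)
    (hbdd : FourierMeasure.RadonMeasure.EquiTranslationBounded μhat) :
    FourierMeasure.FourierTransformable μ' ∧
      ∀ μ'hat : FourierMeasure.RadonMeasure d, FourierMeasure.IsFourierTransform μ' μ'hat →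
        FourierMeasure.RadonMeasure.VagueTendsto μhat μ'hat := by
  obtain ⟨M, hM, hle⟩ := hbdd.exists_bound
  obtain ⟨ν, hν, hνM⟩ := FourierMeasure.RadonMeasure.exists_vagueTendsto hM hle
    (FourierMeasure.exists_tendsto_apply hF hconv (hM 1) (hle 1))
  have hFν : FourierMeasure.IsFourierTransform μ' ν :=
    FourierMeasure.isFourierTransform_of_vagueTendsto hF hconv hν
      -- A common bound: unit balls have mass at most `M 1` along the sequence, but only `M 2` is
      -- known for the limit.
      (max_lt (hM 1).lt_top (hM 2).lt_top).ne
      (fun n t => (hle 1 n t).trans (le_max_left _ _)) fun t => (hνM t).trans (le_max_right _ _)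
  exact ⟨⟨ν, hFν⟩, fun ν' hν' φ => hFν.eq_apply hν' φ ▸ hν φ⟩
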